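/- Let $\Bbbk$ be a field, let $H$ be a Hopf algebra over $\Bbbk$ and let $K$ be a Hopf subalgebra of $H$, that is, a unital subalgebra with $\Delta(K)\subseteq K\otimes K$ and $S_H(K)\subseteq K$. Let $H_{(0)}$ denote the coradical of $H$, i.e. the sum of all simple subcoalgebras of $H$, and call $H$ pointed if $H_{(0)}$ is the $\Bbbk$-linear span of the group-like elements of $H$. Suppose that $H_{(0)}\subseteq K$ or that $H$ is pointed. If $H$ is right (resp. left) Noetherian, then $K$ is right (resp. left) Noetherian. -/

import Mathlib

open scoped TensorProduct

section Coalgebra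

variable (k : Type*) {C : Type*} [Field k] [AddCommGroup C] [Module k C] [Coalgebra k C]

/-- A subcoalgebra of `C`: a `k`-subspace `D` with `Δ(D) ⊆ D ⊗ D`, where `D ⊗ D` is regarded as a
subspace of `C ⊗ C`. -/
def IsSubcoalgebra (D : Submodule k C) : Prop :=
  D.map (Coalgebra.comul (R := k) (A := C)) ≤ LinearMap.range (TensorProduct.mapIncl D D)

/-- A simple subcoalgebra: a nonzero subcoalgebra whose only subcoalgebras are `0` and itself. -/
def IsSimpleSubcoalgebra (D : Submodule k C) : Prop :=
  IsSubcoalgebra k D ∧ D ≠ ⊥ ∧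
    ∀ E : Submodule k C, IsSubcoalgebra k E → E ≤ D → E = ⊥ ∨ E = D

variable (C)

/-- The coradical of `C`: the sum of all simple subcoalgebras of `C`. -/
def coradical : Submodule k C :=
  sSup {D : Submodule k C | IsSimpleSubcoalgebra k D}

/-- `C` is pointed if its coradical is the linear span of its group-like elements. -/
def IsPointedCoalgebra : Prop :=
  coradical k C = Submodule.span k {g : C | IsGroupLikeElem k g}

end Coalgebra

section Hopf

variable {k H : Type*} [Field k] [Ring H] [HopfAlgebra k H]

/-- A Hopf subalgebra of `H`: a (unital) subalgebra which is a subcoalgebra and is stable under the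
antipode. -/
structure IsHopfSubalgebra (K : Subalgebra k H) : Prop where
  isSubcoalgebra : IsSubcoalgebra k (Subalgebra.toSubmodule K)
  antipode_mem : ∀ x ∈ K, HopfAlgebra.antipode k x ∈ K

end Hopf

/-- Left Noetherian: every left ideal is finitely generated. -/
abbrev IsLeftNoetherian (R : Type*) [Ring R] : Prop := IsNoetherianRing R

/-- Right Noetherian: every right ideal is finitely generated, that is, every left ideal of the
opposite ring is. -/
abbrev IsRightNoetherian (R : Type*) [Ring R] : Prop := IsNoetherianRing Rᵐᵒᵖ

/-! It suffices that every right ideal `I` of `K` satisfies `IH ∩ K = I`: extension of right ideals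
to `H` is then strictly monotone, so the ascending chain condition descends
(`IsHopfSubalgebra.isRightNoetherian`).

Instead of showing `H` faithfully flat over `K`, one grows a subspace `F` from `K` to `H`, keeping
it a left coideal, a left `K`-module, and such that `IF ∩ K ⊆ I` for all `I` (`IsPureCoideal`). By
Zorn's lemma it is enough to enlarge a proper `F`. Suppose `h ∉ F` spans a one-dimensional
subcomodule of `H/F`, so that `Δ(h) ≡ g ⊗ h` modulo `H ⊗ F` with `g` group-like. Then `{x ∈ K : xh ∈
F}` is a left ideal and left coideal of `K` missing `1`, hence zero. Thus `F + Kh = F ⊕ Kh` with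
`Kh` free, and purity persists (`IsPureCoideal.sup_mul_semiinvariant`).

To find `h`, take a simple subcomodule of `H/F`; its coefficient matrix `a` has entries in the
coradical (`exists_coefficient_matrix`). If `H` is pointed, the entries are combinations of
group-likes, and projecting to one of them yields `h`. If the coradical lies in `K`, then `S(a)v`
consists of coinvariants, as for Hopf modules, and `v = a S(a)v` shows that they are not all in `F`.

The left-handed statement follows by reversing both multiplication and comultiplication. -/

/-! ### Slice maps: comodule theory expressed through functionals. -/

section Slices

open Coalgebra

variable {k C : Type*} [Field k] [AddCommGroup C] [Module k C]

/-- Two tensors over a field agree as soon as all products of functionals agree on them. -/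
theorem TensorProduct.eq_of_forall_dual {s t : C ⊗[k] C}
    (h : ∀ f g : Module.Dual k C, LinearMap.mul' k k (TensorProduct.map f g s) =
      LinearMap.mul' k k (TensorProduct.map f g t)) : s = t := by
  let b := Module.Basis.ofVectorSpace k C
  have key : ∀ (i j) (u : C ⊗[k] C), (b.tensorProduct b).repr u (i, j) =
      LinearMap.mul' k k (TensorProduct.map (b.coord i) (b.coord j) u) := by
    intro i j u
    induction u with
    | zero => simp
    | tmul x y => simp [mul_comm]
    | add x y hx hy => simp [hx, hy]
  refine (b.tensorProduct b).ext_elem fun ⟨i, j⟩ => ?_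
  rw [key, key, h]

theorem eq_of_forall_dual {x y : C} (h : ∀ f : Module.Dual k C, f x = f y) : x = y :=
  sub_eq_zero.1 ((Module.forall_dual_apply_eq_zero_iff k _).1 fun f => by
    rw [map_sub, h, sub_self])

variable [Coalgebra k C]

/-- The map `c ↦ f(c₁) c₂`. -/
noncomputable def leftSlice (f : Module.Dual k C) : C →ₗ[k] C :=
  (TensorProduct.lid k C).toLinearMap ∘ₗ f.rTensor C ∘ₗ comul

/-- The map `c ↦ c₁ f(c₂)`. -/
noncomputable def rightSlice (f : Module.Dual k C) : C →ₗ[k] C :=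
  (TensorProduct.rid k C).toLinearMap ∘ₗ f.lTensor C ∘ₗ comul

theorem leftSlice_eq_sum {ι : Type*} {s : Finset ι} {x : C} {a b : ι → C}
    (h : comul (R := k) x = ∑ i ∈ s, a i ⊗ₜ[k] b i) (f : Module.Dual k C) :
    leftSlice f x = ∑ i ∈ s, f (a i) • b i := by
  simp [leftSlice, h]

theorem rightSlice_eq_sum {ι : Type*} {s : Finset ι} {x : C} {a b : ι → C}
    (h : comul (R := k) x = ∑ i ∈ s, a i ⊗ₜ[k] b i) (f : Module.Dual k C) :
    rightSlice f x = ∑ i ∈ s, f (b i) • a i := by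
  simp [rightSlice, h]

theorem dual_leftSlice (f g : Module.Dual k C) (x : C) :
    g (leftSlice f x) = LinearMap.mul' k k (TensorProduct.map f g (comul x)) := by
  rw [leftSlice_eq_sum (ℛ k x).eq.symm f, ← (ℛ k x).eq]
  simp

theorem dual_rightSlice (f g : Module.Dual k C) (x : C) :
    f (rightSlice g x) = LinearMap.mul' k k (TensorProduct.map f g (comul x)) := by
  rw [rightSlice_eq_sum (ℛ k x).eq.symm g, ← (ℛ k x).eq]
  simp [mul_comm]

theorem dual_leftSlice_eq_dual_rightSlice (f g : Module.Dual k C) (x : C) :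
    g (leftSlice f x) = f (rightSlice g x) := by
  rw [dual_leftSlice, dual_rightSlice]

@[simp]
theorem leftSlice_counit (x : C) : leftSlice (counit (R := k) (A := C)) x = x := by
  simp [leftSlice]

@[simp]
theorem rightSlice_counit (x : C) : rightSlice (counit (R := k) (A := C)) x = x := by
  simp [rightSlice]

/-- By coassociativity both sides are `f(x₁) x₂ g(x₃)`. This is what makes right slices maps of left
comodules. -/
theorem leftSlice_rightSlice (f g : Module.Dual k C) (x : C) :
    leftSlice f (rightSlice g x) = rightSlice g (leftSlice f x) := by
  have h1 : ∀ t : C ⊗[k] C, leftSlice f (TensorProduct.rid k C (g.lTensor C t)) =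
      TensorProduct.rid k C (g.lTensor C (TensorProduct.lid k (C ⊗[k] C)
        (f.rTensor (C ⊗[k] C) (TensorProduct.assoc k C C C (comul.rTensor C t))))) := by
    intro t
    induction t with
    | zero => simp
    | add x y hx hy => simp [hx, hy]
    | tmul x y =>
      simp only [LinearMap.lTensor_tmul, TensorProduct.rid_tmul, map_smul,
        LinearMap.rTensor_tmul, leftSlice_eq_sum (ℛ k x).eq.symm f]
      rw [← (ℛ k x).eq]
      simp only [TensorProduct.sum_tmul, map_sum, Finset.smul_sum, TensorProduct.assoc_tmul,
        LinearMap.rTensor_tmul, TensorProduct.lid_tmul, map_smul, LinearMap.lTensor_tmul,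
        TensorProduct.rid_tmul]
      exact Finset.sum_congr rfl fun i _ => smul_comm _ _ _
  have h2 : ∀ t : C ⊗[k] C, rightSlice g (TensorProduct.lid k C (f.rTensor C t)) =
      TensorProduct.rid k C (g.lTensor C (TensorProduct.lid k (C ⊗[k] C)
        (f.rTensor (C ⊗[k] C) (comul.lTensor C t)))) := by
    intro t
    induction t with
    | zero => simp
    | add x y hx hy => simp [hx, hy]
    | tmul x y => simp [rightSlice]
  have e1 := h1 (comul x)
  have e2 := h2 (comul x)
  rw [coassoc_apply, ← e2] at e1
  exact e1

theorem leftSlice_leftSlice (f g : Module.Dual k C) (x : C) :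
    leftSlice f (leftSlice g x) = leftSlice (f ∘ₗ leftSlice g) x := by
  refine eq_of_forall_dual (k := k) fun p => ?_
  rw [dual_leftSlice_eq_dual_rightSlice, ← leftSlice_rightSlice,
    dual_leftSlice_eq_dual_rightSlice _ p]
  rfl

theorem comul_eq_sum_of_forall_dual {ι : Type*} {s : Finset ι} {x : C} {a b : ι → C}
    (h : ∀ f g : Module.Dual k C, g (leftSlice f x) = ∑ i ∈ s, f (a i) * g (b i)) :
    comul (R := k) x = ∑ i ∈ s, a i ⊗ₜ[k] b i := by
  refine TensorProduct.eq_of_forall_dual fun f g => ?_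
  rw [← dual_leftSlice, h]
  simp

/-- A subspace is a subcoalgebra if and only if it is stable under all slice maps. -/
theorem isSubcoalgebra_iff {D : Submodule k C} :
    IsSubcoalgebra k D ↔
      ∀ f : Module.Dual k C, ∀ x ∈ D, leftSlice f x ∈ D ∧ rightSlice f x ∈ D := by
  constructor
  · intro h f x hx
    obtain ⟨t, ht⟩ := h (Submodule.mem_map_of_mem hx)
    have hl : ∀ t : D ⊗[k] D,
        TensorProduct.lid k C (f.rTensor C (TensorProduct.mapIncl D D t)) ∈ D ∧
        TensorProduct.rid k C (f.lTensor C (TensorProduct.mapIncl D D t)) ∈ D := by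
      intro t
      induction t with
      | zero => simp
      | add x y hx hy =>
        simp only [map_add]
        exact ⟨D.add_mem hx.1 hy.1, D.add_mem hx.2 hy.2⟩
      | tmul x y =>
        simp only [TensorProduct.mapIncl, TensorProduct.map_tmul, Submodule.subtype_apply,
          LinearMap.rTensor_tmul, LinearMap.lTensor_tmul, TensorProduct.lid_tmul,
          TensorProduct.rid_tmul]
        exact ⟨D.smul_mem _ y.2, D.smul_mem _ x.2⟩
    have := hl t
    rw [ht] at this
    exact this
  · rintro h _ ⟨x, hx, rfl⟩
    obtain ⟨p, hp⟩ := D.subtype.exists_leftInverse_of_injective D.ker_subtype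
    have hp' : ∀ y ∈ D, ((p y : D) : C) = y := fun y hy =>
      congrArg Subtype.val (LinearMap.congr_fun hp ⟨y, hy⟩)
    -- With `p` a linear projection onto `D`, stability under left slices removes `p` from the right
    -- leg of `(p ⊗ p)Δ(x)`, and stability under right slices removes it from the left leg.
    refine ⟨TensorProduct.map p p (comul x), TensorProduct.eq_of_forall_dual fun f g => ?_⟩
    have : LinearMap.mul' k k (TensorProduct.map f g
        (TensorProduct.mapIncl D D (TensorProduct.map p p (comul x)))) =
        LinearMap.mul' k k (TensorProduct.map (f ∘ₗ D.subtype ∘ₗ p) (g ∘ₗ D.subtype ∘ₗ p)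
          (comul x)) := by
      rw [← (ℛ k x).eq]
      simp [TensorProduct.mapIncl]
    rw [this, ← dual_leftSlice, ← dual_leftSlice]
    have h1 := (h (f ∘ₗ D.subtype ∘ₗ p) x hx).1
    simp only [LinearMap.comp_apply, Submodule.subtype_apply] at h1 ⊢
    rw [hp' _ h1, dual_leftSlice_eq_dual_rightSlice, dual_leftSlice_eq_dual_rightSlice]
    simp [hp' _ (h g x hx).2]

end Slices

/-! ### Simple submodules of sums of images of a simple module. -/

section SimpleSubmodules

variable {R M M' : Type*} [Ring R] [AddCommGroup M] [Module R M] [AddCommGroup M'] [Module R M']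

theorem Submodule.exists_isSimpleModule_le (N : Submodule R M) [IsArtinian R N] (hN : N ≠ ⊥) :
    ∃ V ≤ N, IsSimpleModule R V := by
  have := Submodule.nontrivial_iff_ne_bot.2 hN
  obtain ⟨W, hW, -⟩ := (eq_bot_or_exists_atom_le (⊤ : Submodule R N)).resolve_left top_ne_bot
  have := isSimpleModule_iff_isAtom.2 hW
  exact ⟨W.map N.subtype, N.map_subtype_le W,
    IsSimpleModule.congr (W.equivMapOfInjective N.subtype N.injective_subtype).symm⟩

/-- A nonzero submodule of a sum of images of a simple module contains a copy of it. -/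
theorem Submodule.exists_injective_range_le_of_le_iSup_map {ι : Type*} (V : Submodule R M')
    [IsSimpleModule R V] (φ : ι → M' →ₗ[R] M) {E : Submodule R M} (hE : E ≠ ⊥)
    (h : E ≤ ⨆ i, V.map (φ i)) :
    ∃ θ : V →ₗ[R] M, Function.Injective θ ∧ LinearMap.range θ ≤ E := by
  let s : Set (Submodule R M) := Set.range fun i => V.map (φ i)
  have hr : ∀ i, LinearMap.range ((φ i).domRestrict V) = V.map (φ i) := fun i => by
    rw [LinearMap.domRestrict, LinearMap.range_comp, Submodule.range_subtype]
  have hss : ∀ i, IsSemisimpleModule R (V.map (φ i)) := fun i =>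
    hr i ▸ IsSemisimpleModule.range ((φ i).domRestrict V)
  have hs : ∀ m : s, IsSemisimpleModule R m := by
    rintro ⟨_, i, rfl⟩
    exact hss i
  have hsup : E ≤ sSup s := h
  have : IsSemisimpleModule R (⨆ i ∈ (Set.univ : Set ι), V.map (φ i) : Submodule R M) :=
    isSemisimpleModule_biSup_of_isSemisimpleModule_submodule fun i _ => hss i
  have hE' : E ≤ ⨆ i ∈ (Set.univ : Set ι), V.map (φ i) := by simpa using h
  have : IsSemisimpleModule R E :=
    IsSemisimpleModule.of_injective _ (Submodule.inclusion_injective hE')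
  obtain ⟨N, hNE, hN⟩ := (IsSemisimpleModule.eq_bot_or_exists_simple_le E).resolve_left hE
  -- A simple `N ≤ E` embeds in a single image of `V`. That image is then nonzero, hence isomorphic
  -- to `V` and simple, so it is isomorphic to `N`.
  obtain ⟨_, ⟨i, rfl⟩, S, hS, ⟨e⟩⟩ := N.le_linearEquiv_of_le_sSup s (hNE.trans hsup)
  have := IsSimpleModule.nontrivial R N
  have hinj : Function.Injective ((φ i).domRestrict V) := by
    refine LinearMap.injective_of_ne_zero fun h0 => ?_
    have : V.map (φ i) = ⊥ := by rw [← hr, h0, LinearMap.range_zero]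
    obtain ⟨x, hx⟩ := exists_ne (0 : N)
    have hx' : (e x : M) ∈ V.map (φ i) := hS (e x).2
    rw [this, Submodule.mem_bot] at hx'
    exact hx (e.injective (by simpa using hx'))
  have hVs : IsSimpleModule R (V.map (φ i)) :=
    hr i ▸ IsSimpleModule.congr (LinearEquiv.ofInjective _ hinj).symm
  have hSs : IsSimpleModule R S := IsSimpleModule.congr e.symm
  have hSV : S = V.map (φ i) :=
    ((isSimpleModule_iff_isAtom.1 hVs).le_iff_eq (isSimpleModule_iff_isAtom.1 hSs).1).1 hS
  let e' : V ≃ₗ[R] N := (LinearEquiv.ofInjective _ hinj).trans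
    ((LinearEquiv.ofEq _ _ ((hr i).trans hSV.symm)).trans e.symm)
  refine ⟨N.subtype ∘ₗ e'.toLinearMap, N.injective_subtype.comp e'.injective, ?_⟩
  rintro _ ⟨x, rfl⟩
  exact hNE (e' x).2

end SimpleSubmodules

/-- The matrix product rule, in the shape that dualizes to the comultiplication of matrix
coefficients. -/
theorem Module.Basis.coord_apply_apply_eq_sum {ι k V : Type*} [Fintype ι] [Field k]
    [AddCommGroup V] [Module k V] (b : Module.Basis ι k V) (S T : V →ₗ[k] V) (i j : ι) :
    b.coord i (S (T (b j))) = ∑ l, b.coord l (T (b j)) * b.coord i (S (b l)) := by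
  conv_lhs => rw [← b.sum_repr (T (b j)), map_sum, map_sum]
  simp only [map_smul, smul_eq_mul, Module.Basis.coord_apply]

/-! ### Matrix coefficients of simple comodules lie in the coradical. -/

section Coefficients

open Coalgebra

variable (k C : Type*) [Field k] [AddCommGroup C] [Module k C] [Coalgebra k C]

/-- The algebra of all operators `c ↦ f(c₁) c₂` on a coalgebra. Its submodules are the
left coideals. -/
noncomputable def sliceAlgebra : Subalgebra k (Module.End k C) where
  carrier := Set.range (leftSlice (k := k) (C := C))
  mul_mem' := by
    rintro _ _ ⟨f, rfl⟩ ⟨g, rfl⟩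
    exact ⟨f ∘ₗ leftSlice g, LinearMap.ext fun x => (leftSlice_leftSlice f g x).symm⟩
  add_mem' := by
    rintro _ _ ⟨f, rfl⟩ ⟨g, rfl⟩
    exact ⟨f + g, LinearMap.ext fun x => by simp [leftSlice, LinearMap.rTensor_add]⟩
  algebraMap_mem' r := ⟨r • counit, LinearMap.ext fun x => by
    simp [leftSlice, LinearMap.rTensor_smul]⟩

variable {k C}

/-- The operator `c ↦ f(c₁) c₂` as an element of the slice algebra. -/
noncomputable def sliceOp (f : Module.Dual k C) : sliceAlgebra k C := ⟨leftSlice f, f, rfl⟩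

theorem sliceOp_smul (f : Module.Dual k C) (x : C) : sliceOp f • x = leftSlice f x := rfl

theorem exists_eq_sliceOp (a : sliceAlgebra k C) : ∃ f, a = sliceOp f :=
  let ⟨f, hf⟩ := a.2
  ⟨f, Subtype.ext hf.symm⟩

/-- The left coideal given by a subspace stable under left slices. -/
noncomputable def leftCoideal (F : Submodule k C)
    (hF : ∀ f : Module.Dual k C, ∀ x ∈ F, leftSlice f x ∈ F) :
    Submodule (sliceAlgebra k C) C where
  __ := F.toAddSubmonoid
  smul_mem' a x hx := by
    obtain ⟨f, rfl⟩ := exists_eq_sliceOp a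
    exact hF f x hx

/-- The map `c ↦ c₁ f(c₂)` as a map of left comodules. -/
noncomputable def rightSliceHom (f : Module.Dual k C) : C →ₗ[sliceAlgebra k C] C where
  __ := rightSlice f
  map_smul' a x := by
    obtain ⟨g, rfl⟩ := exists_eq_sliceOp a
    exact (leftSlice_rightSlice g f x).symm

variable (F : Submodule (sliceAlgebra k C) C)

instance : IsScalarTower k (sliceAlgebra k C) (C ⧸ F) := inferInstance

noncomputable instance (V : Submodule (sliceAlgebra k C) (C ⧸ F)) : SMul (sliceAlgebra k C) V :=
  V.module.toSMul

/-- The matrix coefficient map `m ↦ m₋₁ φ(m₀)` on the quotient of a coalgebra by a left coideal. -/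
noncomputable def coeffHom (φ : Module.Dual k (C ⧸ F)) : (C ⧸ F) →ₗ[sliceAlgebra k C] C :=
  F.liftQ (rightSliceHom (φ ∘ₗ F.mkQ.restrictScalars k)) fun x hx => by
    refine eq_of_forall_dual (k := k) fun f => ?_
    change f (rightSlice _ x) = f 0
    rw [← dual_leftSlice_eq_dual_rightSlice, map_zero]
    have : F.mkQ (sliceOp f • x) = 0 := by
      rw [Submodule.mkQ_apply, Submodule.Quotient.mk_eq_zero]
      exact F.smul_mem _ hx
    exact (congrArg φ this).trans (map_zero φ)

/-- This determines a coefficient by its values under all functionals; identities between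
coefficients are checked through it. -/
theorem dual_coeffHom (φ : Module.Dual k (C ⧸ F)) (f : Module.Dual k C) (m : C ⧸ F) :
    f (coeffHom F φ m) = φ (sliceOp f • m) := by
  obtain ⟨x, rfl⟩ := F.mkQ_surjective m
  change f (rightSlice _ x) = _
  rw [← dual_leftSlice_eq_dual_rightSlice]
  rfl

/-- Every slice of `x` lies in the span of the right legs of one fixed expression of `Δ(x)`. -/
theorem finiteDimensional_span_singleton (m : C ⧸ F) :
    FiniteDimensional k (Submodule.span (sliceAlgebra k C) {m}) := by
  obtain ⟨x, rfl⟩ := F.mkQ_surjective m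
  let W : Submodule k (C ⧸ F) :=
    Submodule.span k ((fun i => F.mkQ ((ℛ k x).right i)) '' ((ℛ k x).index : Set _))
  have hW : FiniteDimensional k W :=
    FiniteDimensional.span_of_finite k ((Finset.finite_toSet _).image _)
  have hle : (Submodule.span (sliceAlgebra k C) {F.mkQ x}).restrictScalars k ≤ W := by
    intro y hy
    obtain ⟨a, rfl⟩ := Submodule.mem_span_singleton.1 hy
    obtain ⟨f, rfl⟩ := exists_eq_sliceOp a
    rw [← map_smul, sliceOp_smul, leftSlice_eq_sum (ℛ k x).eq.symm f]
    change F.mkQ.restrictScalars k _ ∈ W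
    rw [map_sum]
    refine W.sum_mem fun i hi => ?_
    rw [map_smul]
    exact W.smul_mem _ (Submodule.subset_span ⟨i, hi, rfl⟩)
  exact Submodule.finiteDimensional_of_le hle

/-- A nonzero quotient of a coalgebra by a left coideal has a finite dimensional simple
subcomodule. -/
theorem exists_isSimpleModule_submodule (hF : F ≠ ⊤) :
    ∃ V : Submodule (sliceAlgebra k C) (C ⧸ F),
      IsSimpleModule (sliceAlgebra k C) V ∧ FiniteDimensional k V := by
  obtain ⟨x, -, hx⟩ := SetLike.exists_of_lt (lt_top_iff_ne_top.2 hF)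
  have hm : F.mkQ x ≠ 0 := by simpa using hx
  let N := Submodule.span (sliceAlgebra k C) {F.mkQ x}
  have hN : FiniteDimensional k N := finiteDimensional_span_singleton F _
  have : IsArtinian (sliceAlgebra k C) N := isArtinian_of_tower k inferInstance
  obtain ⟨V, hVN, hV⟩ := N.exists_isSimpleModule_le fun h => hm <| by
    rw [← Submodule.mem_bot (sliceAlgebra k C), ← h]
    exact Submodule.mem_span_singleton_self _
  have : FiniteDimensional k (N.restrictScalars k) := hN
  exact ⟨V, hV, Submodule.finiteDimensional_of_le (S₂ := N.restrictScalars k)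
    (S₁ := V.restrictScalars k) hVN⟩

/-- The space of matrix coefficients of a simple comodule is a simple subcoalgebra. -/
theorem isSimpleSubcoalgebra_coeff (V : Submodule (sliceAlgebra k C) (C ⧸ F))
    [IsSimpleModule (sliceAlgebra k C) V] :
    IsSimpleSubcoalgebra k
      ((⨆ φ : Module.Dual k (C ⧸ F), V.map (coeffHom F φ)).restrictScalars k) := by
  set D := ⨆ φ : Module.Dual k (C ⧸ F), V.map (coeffHom F φ) with hD
  have hmem : ∀ φ, ∀ v ∈ V, coeffHom F φ v ∈ D := fun φ v hv =>
    Submodule.mem_iSup_of_mem φ (Submodule.mem_map_of_mem hv)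
  refine ⟨isSubcoalgebra_iff.2 fun f x hx => ⟨D.smul_mem (sliceOp f) hx, ?_⟩, ?_, ?_⟩
  · suffices h : D ≤ D.comap (rightSliceHom f) from h hx
    refine iSup_le fun φ => Submodule.map_le_iff_le_comap.2 fun v hv => ?_
    -- A right slice of a coefficient of `v` is again a coefficient of `v`, for the functional `φ`
    -- precomposed with the action of `f`.
    have : rightSliceHom f (coeffHom F φ v) =
        coeffHom F (φ ∘ₗ (DistribSMul.toLinearMap k (C ⧸ F) (sliceOp f))) v := by
      refine eq_of_forall_dual (k := k) fun g => ?_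
      rw [dual_coeffHom]
      change g (rightSlice f _) = φ (sliceOp f • sliceOp g • v)
      rw [← dual_leftSlice_eq_dual_rightSlice, ← sliceOp_smul, ← map_smul, dual_coeffHom]
    change rightSliceHom f (coeffHom F φ v) ∈ D
    rw [this]
    exact hmem _ _ hv
  · have := IsSimpleModule.nontrivial (sliceAlgebra k C) V
    obtain ⟨v, hv⟩ := exists_ne (0 : V)
    have hv' : (v : C ⧸ F) ≠ 0 := fun h => hv (Subtype.ext h)
    intro hbot
    refine hv' ((Module.forall_dual_apply_eq_zero_iff k _).1 fun φ => ?_)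
    have h0 : coeffHom F φ v = 0 := by
      have := hmem φ v v.2
      rw [← Submodule.restrictScalars_mem k, hbot] at this
      simpa using this
    -- The counit acts as the identity, so it recovers `φ v` from the coefficient.
    have h1 := dual_coeffHom F φ counit (v : C ⧸ F)
    rw [h0, map_zero] at h1
    have : sliceOp (counit (R := k) (A := C)) = 1 :=
      Subtype.ext (LinearMap.ext fun x => leftSlice_counit x)
    rw [this, one_smul] at h1
    exact h1.symm
  · intro E hE hED
    refine or_iff_not_imp_left.2 fun hE0 => le_antisymm hED ?_
    have hE' := isSubcoalgebra_iff.1 hE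
    let E' := leftCoideal E fun f x hx => (hE' f x hx).1
    have hE'D : E' ≤ D := hED
    have hE'0 : E' ≠ ⊥ := fun h => hE0 ((Submodule.eq_bot_iff _).2 fun x hx =>
      (Submodule.eq_bot_iff _).1 h x hx)
    obtain ⟨θ, hθ, hθE⟩ := V.exists_injective_range_le_of_le_iSup_map (coeffHom F) hE'0 hE'D
    suffices h : D ≤ E' from h
    refine iSup_le fun φ => Submodule.map_le_iff_le_comap.2 fun v hv => ?_
    obtain ⟨p, hp⟩ := (θ.restrictScalars k).exists_leftInverse_of_injective
      (LinearMap.ker_eq_bot.2 hθ)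
    have hp' : ∀ u : V, p (θ u) = u := fun u => LinearMap.congr_fun hp u
    -- `E` contains a copy `θ(V)` of `V`. Transporting `φ` along `θ` turns each coefficient of `V`
    -- into a right slice of an element of `θ(V)`, which stays in `E`.
    let ψ : Module.Dual k C := φ ∘ₗ V.subtype.restrictScalars k ∘ₗ p
    have : coeffHom F φ v = rightSlice ψ (θ ⟨v, hv⟩) := by
      refine eq_of_forall_dual (k := k) fun f => ?_
      rw [dual_coeffHom, ← dual_leftSlice_eq_dual_rightSlice, ← sliceOp_smul, ← map_smul]
      simp only [ψ, LinearMap.comp_apply, hp']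
      rfl
    change coeffHom F φ v ∈ E
    rw [this]
    exact (hE' ψ _ (hθE ⟨_, rfl⟩)).2

set_option maxHeartbeats 1000000 in
/-- Every proper left coideal `F` of a coalgebra admits, modulo `F`, a nonzero finite dimensional
comodule whose coefficient matrix lies in the coradical. -/
theorem exists_coefficient_matrix (F : Submodule k C)
    (hF : ∀ f : Module.Dual k C, ∀ x ∈ F, leftSlice f x ∈ F) (hFtop : F ≠ ⊤) :
    ∃ (n : ℕ) (v : Fin n → C) (a : Matrix (Fin n) (Fin n) C), (∃ i, v i ∉ F) ∧
      (∀ i j, a i j ∈ coradical k C) ∧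
      (∀ (f : Module.Dual k C) i, leftSlice f (v i) - ∑ j, f (a i j) • v j ∈ F) ∧
      (∀ i j, counit (R := k) (a i j) = (1 : Matrix (Fin n) (Fin n) k) i j) ∧
      (∀ i j, comul (R := k) (a i j) = ∑ l, a i l ⊗ₜ[k] a l j) := by
  let F' := leftCoideal F hF
  have hF' : F' ≠ ⊤ := fun h => hFtop ((Submodule.eq_top_iff').2 fun x =>
    (Submodule.eq_top_iff').1 h x)
  obtain ⟨V, hV, hVfin⟩ := exists_isSimpleModule_submodule F' hF'
  let b := Module.finBasis k V
  obtain ⟨p, hp⟩ := (V.subtype.restrictScalars k).exists_leftInverse_of_injective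
    (LinearMap.ker_eq_bot.2 V.injective_subtype)
  have hp' : ∀ u : V, p u = u := fun u => LinearMap.congr_fun hp u
  choose v hv using fun j => F'.mkQ_surjective (b j : C ⧸ F')
  let e : Fin (Module.finrank k V) → Fin (Module.finrank k V) → C := fun i j =>
    coeffHom F' (b.coord i ∘ₗ p) (b j)
  obtain ⟨T, hT⟩ : ∃ T : Module.Dual k C → V →ₗ[k] V,
      ∀ f u, (T f u : C ⧸ F') = sliceOp f • (u : C ⧸ F') :=
    ⟨fun f => (DistribSMul.toLinearMap k (C ⧸ F') (sliceOp f)).restrict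
      (p := V.restrictScalars k) (q := V.restrictScalars k)
      fun u hu => V.smul_mem (sliceOp f) hu, fun f u => rfl⟩
  have hTcomp : ∀ f g u, T (f ∘ₗ leftSlice g) u = T f (T g u) := by
    intro f g u
    refine Subtype.ext ?_
    rw [hT, hT, hT, ← mul_smul]
    congr 1
    exact Subtype.ext (LinearMap.ext fun x => (leftSlice_leftSlice f g x).symm)
  have he : ∀ (f : Module.Dual k C) i j, f (e i j) = b.coord i (T f (b j)) := by
    intro f i j
    simp only [e]
    rw [dual_coeffHom, ← hT]
    exact congrArg (b.coord i) (hp' (T f (b j)))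
  have hrep : ∀ (f : Module.Dual k C) j, T f (b j) = ∑ i, f (e i j) • b i := by
    intro f j
    simp only [he]
    exact (b.sum_repr (T f (b j))).symm
  -- The transpose is needed because slices compose as the opposite of convolution: `Δ(e i j) = ∑ e
  -- l j ⊗ e i l`.
  refine ⟨_, v, fun j i => e i j, ?_, ?_, ?_, ?_, ?_⟩
  · have := IsSimpleModule.nontrivial (sliceAlgebra k C) V
    obtain ⟨j⟩ := b.index_nonempty
    refine ⟨j, fun hj => b.ne_zero j (Subtype.ext ?_)⟩
    rw [← hv j]
    exact (Submodule.Quotient.mk_eq_zero F').2 hj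
  · intro j i
    exact le_sSup (a := (⨆ φ : Module.Dual k (C ⧸ F'), V.map (coeffHom F' φ)).restrictScalars k)
      (isSimpleSubcoalgebra_coeff F' V)
      (Submodule.mem_iSup_of_mem (b.coord i ∘ₗ p) (Submodule.mem_map_of_mem (b j).2))
  · intro f j
    change _ ∈ F'
    rw [← Submodule.Quotient.mk_eq_zero, ← Submodule.mkQ_apply]
    change F'.mkQ.restrictScalars k _ = 0
    rw [map_sub, map_sum, sub_eq_zero]
    simp only [map_smul, LinearMap.restrictScalars_apply, hv]
    rw [← sliceOp_smul, map_smul, hv, ← hT, hrep]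
    exact map_sum (V.subtype.restrictScalars k) _ _
  · intro j i
    have : T (counit (R := k) (A := C)) (b j) = b j := by
      refine Subtype.ext ((hT _ _).trans ?_)
      rw [← hv, ← map_smul, sliceOp_smul, leftSlice_counit]
    rw [he, this]
    simp [Finsupp.single_apply, Matrix.one_apply]
  · intro j i
    refine comul_eq_sum_of_forall_dual fun f g => ?_
    have : g (leftSlice f (e i j)) = b.coord i (T g (T f (b j))) := by
      rw [← hTcomp, ← he]
      rfl
    simpa only [he] using this.trans (b.coord_apply_apply_eq_sum (T g) (T f) i j)

end Coefficients

/-! ### Existence of semi-invariants in quotients by left coideals. -/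

section Hopf

open Coalgebra HopfAlgebra

variable {k H : Type*} [Field k] [Ring H] [HopfAlgebra k H]

theorem leftSlice_mul {ι : Type*} {s : Finset ι} {x : H} {a b : ι → H}
    (hx : comul (R := k) x = ∑ i ∈ s, a i ⊗ₜ[k] b i) (f : Module.Dual k H) (h : H) :
    leftSlice f (x * h) = ∑ i ∈ s, b i * leftSlice (f ∘ₗ LinearMap.mulLeft k (a i)) h := by
  have key : ∀ t : H ⊗[k] H, TensorProduct.lid k H (f.rTensor H (comul x * t)) =
      ∑ i ∈ s, b i * TensorProduct.lid k H ((f ∘ₗ LinearMap.mulLeft k (a i)).rTensor H t) := by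
    intro t
    induction t with
    | zero => simp
    | add t u ht hu => simp only [mul_add, map_add, ht, hu, Finset.sum_add_distrib]
    | tmul p q => simp [hx, Finset.sum_mul]
  have := key (comul h)
  rw [← Bialgebra.comul_mul] at this
  exact this

/-- The antipode inverts a comultiplicative matrix. -/
theorem antipode_map_mul_of_comul {n : Type*} [Fintype n] [DecidableEq n] {a : Matrix n n H}
    (hε : ∀ i j, counit (R := k) (a i j) = (1 : Matrix n n k) i j)
    (hΔ : ∀ i j, comul (R := k) (a i j) = ∑ l, a i l ⊗ₜ[k] a l j) :
    a.map (antipode k) * a = 1 := by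
  ext i j
  have := mul_antipode_rTensor_comul_apply (R := k) (a i j)
  rw [hΔ, hε] at this
  simpa [Matrix.mul_apply, Matrix.one_apply, apply_ite] using this

theorem mul_antipode_map_of_comul {n : Type*} [Fintype n] [DecidableEq n] {a : Matrix n n H}
    (hε : ∀ i j, counit (R := k) (a i j) = (1 : Matrix n n k) i j)
    (hΔ : ∀ i j, comul (R := k) (a i j) = ∑ l, a i l ⊗ₜ[k] a l j) :
    a * a.map (antipode k) = 1 := by
  ext i j
  have := mul_antipode_lTensor_comul_apply (R := k) (a i j)
  rw [hΔ, hε] at this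
  simpa [Matrix.mul_apply, Matrix.one_apply, apply_ite] using this

/-- Over `H ⊗ H` one has `Δ(a) = (a ⊗ 1)(1 ⊗ a)`. With `s = S(a)`, the matrix `Δ(s)` is a left
inverse of it and `(1 ⊗ s)(s ⊗ 1)` a right inverse, so they agree. -/
theorem comul_antipode_of_comul {n : Type*} [Fintype n] [DecidableEq n] {a : Matrix n n H}
    (hε : ∀ i j, counit (R := k) (a i j) = (1 : Matrix n n k) i j)
    (hΔ : ∀ i j, comul (R := k) (a i j) = ∑ l, a i l ⊗ₜ[k] a l j) (i j : n) :
    comul (R := k) (antipode k (a i j)) = ∑ l, antipode k (a l j) ⊗ₜ[k] antipode k (a i l) := by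
  let Δ : Matrix n n H →+* Matrix n n (H ⊗[k] H) :=
    (Bialgebra.comulAlgHom k H).toRingHom.mapMatrix
  let L : Matrix n n H →+* Matrix n n (H ⊗[k] H) :=
    (Algebra.TensorProduct.includeLeft : H →ₐ[k] H ⊗[k] H).toRingHom.mapMatrix
  let R : Matrix n n H →+* Matrix n n (H ⊗[k] H) :=
    (Algebra.TensorProduct.includeRight : H →ₐ[k] H ⊗[k] H).toRingHom.mapMatrix
  have hΔa : Δ a = L a * R a := by
    ext i j
    simp [Δ, L, R, Matrix.mul_apply, hΔ]
  set s := a.map (antipode k) with hs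
  have h1 : Δ s * Δ a = 1 := by
    rw [← map_mul, antipode_map_mul_of_comul hε hΔ, map_one]
  have has : a * s = 1 := mul_antipode_map_of_comul hε hΔ
  have h2 : Δ a * (R s * L s) = 1 := by
    rw [hΔa, mul_assoc, ← mul_assoc (R a), ← map_mul R, has, map_one, one_mul, ← map_mul, has,
      map_one]
  have h3 := congrArg (fun M : Matrix n n (H ⊗[k] H) => M i j) (left_inv_eq_right_inv h1 h2)
  simpa [Δ, L, R, Matrix.mul_apply, hs] using h3

/-- A nonzero comodule with coefficients in the span of the group-like elements contains a
nonzero semi-invariant. -/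
theorem exists_semiinvariant_of_isPointed (hp : IsPointedCoalgebra k H) (F : Submodule k H)
    (hF : ∀ f : Module.Dual k H, ∀ x ∈ F, leftSlice f x ∈ F) (hFtop : F ≠ ⊤) :
    ∃ g h : H, IsGroupLikeElem k g ∧ h ∉ F ∧
      ∀ f : Module.Dual k H, leftSlice f h - f g • h ∈ F := by
  classical
  obtain ⟨n, v, a, ⟨i, hi⟩, ha, hact, -, -⟩ := exists_coefficient_matrix F hF hFtop
  have hli := linearIndep_groupLikeVal (R := k) (A := H)
  have hrange : Set.range (GroupLike.val (R := k) (A := H)) = {g | IsGroupLikeElem k g} := by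
    ext g
    exact ⟨fun ⟨x, hx⟩ => hx ▸ x.2, fun hg => ⟨⟨g, hg⟩, rfl⟩⟩
  rw [IsPointedCoalgebra, ← hrange] at hp
  rw [hp] at ha
  choose p hp' using fun g : GroupLike k H =>
    LinearMap.exists_extend (Finsupp.lapply g ∘ₗ hli.repr : _ →ₗ[k] k)
  have hpx : ∀ g x, (hx : x ∈ Submodule.span k (Set.range (GroupLike.val (R := k) (A := H)))) →
      p g x = hli.repr ⟨x, hx⟩ g := fun g x hx => LinearMap.congr_fun (hp' g) ⟨x, hx⟩
  have hpg : ∀ g g' : GroupLike k H, p g g'.val = if g' = g then 1 else 0 := by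
    intro g g'
    have hx := Submodule.subset_span (R := k) (Set.mem_range_self (f := GroupLike.val (R := k)) g')
    rw [hpx g g'.val hx, hli.repr_eq_single g' ⟨_, hx⟩ rfl, Finsupp.single_apply]
  have hslice : ∀ g x, x ∈ Submodule.span k (Set.range (GroupLike.val (R := k) (A := H))) →
      leftSlice (p g) x = p g x • g.val := by
    intro g x hx
    induction hx using Submodule.span_induction with
    | zero => simp
    | add x y _ _ hx hy => rw [map_add, map_add, add_smul, hx, hy]
    | smul c x _ hx => rw [map_smul, map_smul, hx, smul_assoc]
    | mem x hx =>
      obtain ⟨g', rfl⟩ := hx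
      have : leftSlice (p g) g'.val = p g g'.val • g'.val := by
        simp [leftSlice, g'.2.comul_eq_tmul_self]
      rw [this, hpg]
      split_ifs with h
      · rw [h]
      · simp
  -- On the entries of row `i` the counit is a finite sum of the coordinate functionals `p g`, so if
  -- all these slices were in `F`, so would be `v i`.
  obtain ⟨g, hg⟩ : ∃ g, leftSlice (p g) (v i) ∉ F := by
    by_contra! hcon
    refine hi ?_
    have h1 := hact counit i
    rw [leftSlice_counit] at h1
    refine (F.sub_mem_iff_left ?_).1 h1
    let s : Finset (GroupLike k H) := Finset.univ.biUnion fun j => (hli.repr ⟨_, ha i j⟩).support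
    have hsum : ∀ j, counit (R := k) (a i j) = ∑ g ∈ s, p g (a i j) := by
      intro j
      have h2 := hli.linearCombination_repr ⟨_, ha i j⟩
      rw [Finsupp.linearCombination_apply, Finsupp.sum_of_support_subset (s := s) _
        (Finset.subset_biUnion_of_mem (fun j => (hli.repr ⟨_, ha i j⟩).support)
          (Finset.mem_univ j)) _ (by simp)] at h2
      refine (congrArg (counit (R := k)) h2).symm.trans ?_
      rw [map_sum]
      refine Finset.sum_congr rfl fun g _ => ?_
      rw [hpx g _ (ha i j), map_smul, g.2.counit_eq_one, smul_eq_mul, mul_one]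
    have h3 : ∑ j, counit (R := k) (a i j) • v j = ∑ g ∈ s, ∑ j, p g (a i j) • v j := by
      rw [Finset.sum_comm]
      simp only [hsum, Finset.sum_smul]
    rw [h3]
    exact F.sum_mem fun g _ => (F.sub_mem_iff_right (hcon g)).1 (hact (p g) i)
  refine ⟨g.val, _, g.2, hg, fun f => ?_⟩
  have h1 := hact (f ∘ₗ leftSlice (p g)) i
  have h2 := F.smul_mem (f g.val) (hact (p g) i)
  rw [leftSlice_leftSlice]
  have h3 := F.sub_mem h1 h2
  simp only [LinearMap.comp_apply, hslice g _ (ha i _), map_smul, smul_sub, Finset.smul_sum,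
    smul_eq_mul, mul_smul, smul_comm (p g _) (f g.val)] at h3
  rwa [sub_sub_sub_cancel_right] at h3

/-- If `K` contains the coradical, every proper left coideal which is a left `K`-submodule
admits a nonzero coinvariant in the quotient. -/
theorem exists_coinvariant_of_coradical_le {K : Subalgebra k H} (hK : IsHopfSubalgebra K)
    (hcor : coradical k H ≤ Subalgebra.toSubmodule K) (F : Submodule k H)
    (hF : ∀ f : Module.Dual k H, ∀ x ∈ F, leftSlice f x ∈ F)
    (hKF : ∀ x ∈ K, ∀ y ∈ F, x * y ∈ F) (hFtop : F ≠ ⊤) :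
    ∃ g h : H, IsGroupLikeElem k g ∧ h ∉ F ∧
      ∀ f : Module.Dual k H, leftSlice f h - f g • h ∈ F := by
  obtain ⟨n, v, a, ⟨r, hr⟩, ha, hact, hε, hΔ⟩ := exists_coefficient_matrix F hF hFtop
  have haK : ∀ i j, a i j ∈ K := fun i j => hcor (ha i j)
  have hsa := antipode_map_mul_of_comul hε hΔ
  have has := mul_antipode_map_of_comul hε hΔ
  have hΔs := comul_antipode_of_comul hε hΔ
  -- Modulo `F` the coaction sends `u j` to `∑ S(a l i) a i m ⊗ S(a j l) v m`, which collapses to `1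
  -- ⊗ u j` because `S(a) a = 1`.
  let u : Fin n → H := fun j => ∑ i, antipode k (a j i) * v i
  obtain ⟨j, hj⟩ : ∃ j, u j ∉ F := by
    by_contra! hcon
    have : ∑ j, a r j * u j = v r := by
      simp only [u, Finset.mul_sum, ← mul_assoc]
      rw [Finset.sum_comm]
      have h1 : ∀ i, ∑ j, a r j * antipode k (a j i) = (1 : Matrix _ _ H) r i := fun i => by
        rw [← has, Matrix.mul_apply]
        rfl
      simp only [← Finset.sum_mul, h1, Matrix.one_apply, ite_mul, one_mul, zero_mul,
        Finset.sum_ite_eq, Finset.mem_univ, if_true]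
    exact hr (this ▸ F.sum_mem fun j _ => hKF _ (haK r j) _ (hcon j))
  refine ⟨1, u j, .one, hj, fun f => ?_⟩
  have h1 : leftSlice f (u j) = ∑ i, ∑ l, antipode k (a j l) *
      leftSlice (f ∘ₗ LinearMap.mulLeft k (antipode k (a l i))) (v i) := by
    simp only [u, map_sum]
    exact Finset.sum_congr rfl fun i _ => leftSlice_mul (hΔs j i) f (v i)
  have h2 : f 1 • u j = ∑ i, ∑ l, antipode k (a j l) *
      ∑ m, (f ∘ₗ LinearMap.mulLeft k (antipode k (a l i))) (a i m) • v m := by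
    have h3 : ∀ l m, ∑ i, f (antipode k (a l i) * a i m) = f ((1 : Matrix _ _ H) l m) := by
      intro l m
      rw [← hsa, Matrix.mul_apply, map_sum]
      rfl
    rw [Finset.sum_comm]
    simp only [← Finset.mul_sum]
    have h4 : ∀ l, ∑ i, ∑ m, (f ∘ₗ LinearMap.mulLeft k (antipode k (a l i))) (a i m) • v m =
        f 1 • v l := by
      intro l
      rw [Finset.sum_comm]
      simp only [← Finset.sum_smul, LinearMap.comp_apply, LinearMap.mulLeft_apply, h3]
      rw [Finset.sum_eq_single l]
      · simp
      · intro m _ hm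
        simp [Matrix.one_apply_ne hm.symm]
      · simp
    simp only [h4, u, Finset.smul_sum, mul_smul_comm]
  rw [h1, h2, ← Finset.sum_sub_distrib]
  refine F.sum_mem fun i _ => ?_
  rw [← Finset.sum_sub_distrib]
  refine F.sum_mem fun l _ => ?_
  rw [← mul_sub]
  exact hKF _ (hK.antipode_mem _ (haK j l)) _ (hact _ i)

end Hopf

/-! ### Pure coideals and contraction of right ideals. -/

section Purity

open Coalgebra HopfAlgebra

variable {k H : Type*} [Field k] [Ring H] [HopfAlgebra k H]

/-- On elements of a subcoalgebra the comultiplication can be written with linearly independent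
left components, which identifies the right components as slices. -/
theorem IsSubcoalgebra.exists_comul_eq_sum {C : Type*} [AddCommGroup C] [Module k C]
    [Coalgebra k C] {D : Submodule k C} (hD : IsSubcoalgebra k D) {x : C} (hx : x ∈ D) :
    ∃ (s : Finset (Module.Basis.ofVectorSpaceIndex k D)) (a b : _ → C),
      comul (R := k) x = ∑ i ∈ s, a i ⊗ₜ[k] b i ∧ (∀ i, a i ∈ D) ∧
        ∀ i ∈ s, ∃ f : Module.Dual k C, b i = leftSlice f x := by
  classical
  obtain ⟨t, ht⟩ := hD (Submodule.mem_map_of_mem hx)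
  let B := Module.Basis.ofVectorSpace k D
  obtain ⟨c, rfl⟩ := TensorProduct.eq_repr_basis_left B t
  have hc : comul (R := k) x = ∑ i ∈ c.support, (B i : C) ⊗ₜ[k] (c i : C) := by
    rw [← ht, Finsupp.sum, map_sum]
    rfl
  refine ⟨c.support, fun i => B i, fun i => c i, hc, fun i => (B i).2, fun i hi => ?_⟩
  obtain ⟨f, hf⟩ := LinearMap.exists_extend (B.coord i)
  have hf' : ∀ j, f (B j) = if j = i then 1 else 0 := fun j => by
    rw [← Submodule.subtype_apply, ← LinearMap.comp_apply, hf]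
    simp [Finsupp.single_apply]
  refine ⟨f, ?_⟩
  rw [leftSlice_eq_sum hc]
  simp only [hf', ite_smul, one_smul, zero_smul]
  rw [Finset.sum_ite_eq' c.support i fun j => (c j : C), if_pos hi]

/-- A proper left ideal of a Hopf subalgebra which is a left coideal vanishes. -/
theorem eq_zero_of_mem_leftIdeal_leftCoideal {K : Subalgebra k H} (hK : IsHopfSubalgebra K)
    {J : Submodule k H} (hJK : ∀ x ∈ J, x ∈ K) (hmul : ∀ x ∈ K, ∀ y ∈ J, x * y ∈ J)
    (hJ : ∀ f : Module.Dual k H, ∀ x ∈ J, leftSlice f x ∈ J) (h1 : (1 : H) ∉ J)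
    {x : H} (hx : x ∈ J) : x = 0 := by
  have hε : ∀ y ∈ J, counit (R := k) y = 0 := by
    intro y hy
    obtain ⟨s, a, b, hab, ha, hb⟩ := hK.isSubcoalgebra.exists_comul_eq_sum (hJK y hy)
    -- Since `y₁ ∈ K` and `y₂ ∈ J`, the identity `S(y₁)y₂ = ε(y)1` would put `1` in `J` if `ε(y) ≠
    -- 0`.
    by_contra hne
    refine h1 ?_
    have h2 : algebraMap k H (counit y) ∈ J := by
      rw [← mul_antipode_rTensor_comul_apply (R := k) y, hab, map_sum, map_sum]
      refine J.sum_mem fun i hi => ?_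
      obtain ⟨f, hf⟩ := hb i hi
      exact hmul _ (hK.antipode_mem _ (ha i)) _ (hf ▸ hJ f y hy)
    rw [Algebra.algebraMap_eq_smul_one] at h2
    exact (J.smul_mem_iff hne).1 h2
  obtain ⟨s, a, b, hab, ha, hb⟩ := hK.isSubcoalgebra.exists_comul_eq_sum (hJK x hx)
  -- Now `x = x₁ ε(x₂)` with `x₂ ∈ J`, where the counit vanishes.
  rw [← rightSlice_counit (k := k) x, rightSlice_eq_sum hab]
  refine Finset.sum_eq_zero fun i hi => ?_
  obtain ⟨f, hf⟩ := hb i hi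
  rw [hε _ (hf ▸ hJ f x hx), zero_smul]

/-- A left coideal and left `K`-submodule `F` of `H` containing `K` such that `K` is pure in `F` on
the level of right ideals. -/
structure IsPureCoideal (K : Subalgebra k H) (F : Submodule k H) : Prop where
  le : Subalgebra.toSubmodule K ≤ F
  mul_mem : ∀ x ∈ K, ∀ y ∈ F, x * y ∈ F
  leftSlice_mem : ∀ f : Module.Dual k H, ∀ x ∈ F, leftSlice f x ∈ F
  pure : ∀ I : Submodule k H, I ≤ Subalgebra.toSubmodule K → (∀ i ∈ I, ∀ x ∈ K, i * x ∈ I) →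
    I * F ⊓ Subalgebra.toSubmodule K ≤ I

/-- A semi-invariant of the quotient by `F` generates a free `K`-module of rank one. -/
theorem eq_zero_of_mul_semiinvariant_mem {K : Subalgebra k H} (hK : IsHopfSubalgebra K)
    {F : Submodule k H} (hmul : ∀ x ∈ K, ∀ y ∈ F, x * y ∈ F) {g h : H}
    (hg : IsGroupLikeElem k g) (hh : h ∉ F)
    (hgh : ∀ f : Module.Dual k H, leftSlice f h - f g • h ∈ F)
    (hF : ∀ f : Module.Dual k H, ∀ x ∈ F, leftSlice f x ∈ F) {x : H} (hx : x ∈ K)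
    (hxh : x * h ∈ F) : x = 0 := by
  let J : Submodule k H := Subalgebra.toSubmodule K ⊓ F.comap (LinearMap.mulRight k h)
  refine eq_zero_of_mem_leftIdeal_leftCoideal hK (J := J) (fun y hy => hy.1) ?_ ?_ ?_ ⟨hx, hxh⟩
  · intro y hy z hz
    refine ⟨K.mul_mem hy hz.1, ?_⟩
    have := hmul y hy _ hz.2
    simpa [mul_assoc] using this
  · intro f y hy
    have hKs := isSubcoalgebra_iff.1 hK.isSubcoalgebra
    refine ⟨(hKs f y hy.1).1, ?_⟩
    obtain ⟨s, a, b, hab, -, hb⟩ := hK.isSubcoalgebra.exists_comul_eq_sum hy.1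
    -- Modulo `H ⊗ F`, `Δ(yh)` is `y₁g ⊗ y₂h`. Twisting `f` by `S(g) = g⁻¹` cancels the factor `g`.
    let f' : Module.Dual k H := f ∘ₗ LinearMap.mulRight k (antipode k g)
    have h1 : leftSlice f' (y * h) ∈ F := hF f' _ hy.2
    rw [leftSlice_mul hab] at h1
    change leftSlice f y * h ∈ F
    rw [leftSlice_eq_sum hab, Finset.sum_mul]
    refine (F.sub_mem_iff_right h1).1 ?_
    rw [← Finset.sum_sub_distrib]
    refine F.sum_mem fun i hi => ?_
    obtain ⟨p, hp⟩ := hb i hi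
    have hbK : b i ∈ K := hp ▸ (hKs p y hy.1).1
    have h2 := hmul _ hbK _ (hgh (f' ∘ₗ LinearMap.mulLeft k (a i)))
    have h3 : f' (a i * g) = f (a i) := by
      simp [f', mul_assoc, hg.mul_antipode_cancel]
    rw [mul_sub, LinearMap.comp_apply, LinearMap.mulLeft_apply, h3, mul_smul_comm,
      ← smul_mul_assoc] at h2
    exact h2
  · intro h1
    have h2 : (1 : H) * h ∈ F := h1.2
    rw [one_mul] at h2
    exact hh h2

theorem IsPureCoideal.sup_mul_semiinvariant {K : Subalgebra k H} (hK : IsHopfSubalgebra K)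
    {F : Submodule k H} (hF : IsPureCoideal K F) {g h : H} (hg : IsGroupLikeElem k g) (hh : h ∉ F)
    (hgh : ∀ f : Module.Dual k H, leftSlice f h - f g • h ∈ F) :
    IsPureCoideal K (F ⊔ (Subalgebra.toSubmodule K).map (LinearMap.mulRight k h)) := by
  have hfree : ∀ x ∈ K, x * h ∈ F → x = 0 := fun x hx hxh =>
    eq_zero_of_mul_semiinvariant_mem hK hF.mul_mem hg hh hgh hF.leftSlice_mem hx hxh
  set G := (Subalgebra.toSubmodule K).map (LinearMap.mulRight k h) with hG
  have hGmem : ∀ x ∈ K, x * h ∈ G := fun x hx => ⟨x, hx, rfl⟩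
  have hKs := isSubcoalgebra_iff.1 hK.isSubcoalgebra
  refine ⟨hF.le.trans le_sup_left, ?_, ?_, ?_⟩
  · intro x hx y hy
    obtain ⟨y, hyF, _, ⟨z, hz, rfl⟩, rfl⟩ := Submodule.mem_sup.1 hy
    rw [mul_add]
    refine Submodule.add_mem_sup (hF.mul_mem x hx y hyF) ?_
    rw [LinearMap.mulRight_apply, ← mul_assoc]
    exact hGmem _ (K.mul_mem hx hz)
  · intro f y hy
    obtain ⟨y, hyF, _, ⟨z, hz, rfl⟩, rfl⟩ := Submodule.mem_sup.1 hy
    rw [map_add]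
    refine Submodule.add_mem _ (Submodule.mem_sup_left (hF.leftSlice_mem f y hyF)) ?_
    obtain ⟨s, a, b, hab, -, hb⟩ := hK.isSubcoalgebra.exists_comul_eq_sum hz
    rw [LinearMap.mulRight_apply, leftSlice_mul hab]
    refine Submodule.sum_mem _ fun i hi => ?_
    obtain ⟨p, hp⟩ := hb i hi
    have hbK : b i ∈ K := hp ▸ (hKs p z hz).1
    set q := f ∘ₗ LinearMap.mulLeft k (a i)
    have h1 : b i * leftSlice q h = b i * (leftSlice q h - q g • h) + (q g • b i) * h := by
      rw [mul_sub, smul_mul_assoc, mul_smul_comm, sub_add_cancel]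
    rw [h1]
    exact Submodule.add_mem_sup (hF.mul_mem _ hbK _ (hgh q)) (hGmem _ (K.smul_mem hbK _))
  · rintro I hIK hI y ⟨hy, hyK⟩
    rw [SetLike.mem_coe, Submodule.mul_sup] at hy
    obtain ⟨y₁, hy₁, y₂, hy₂, rfl⟩ := Submodule.mem_sup.1 hy
    have hIG : I * G ≤ I.map (LinearMap.mulRight k h) := by
      refine Submodule.mul_le.2 ?_
      rintro i hi _ ⟨z, hz, rfl⟩
      exact ⟨i * z, hI i hi z hz, by simp [mul_assoc]⟩
    obtain ⟨i, hi, rfl⟩ := hIG hy₂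
    have hIF : I * F ≤ F := Submodule.mul_le.2 fun i hi z hz => hF.mul_mem i (hIK hi) z hz
    -- The whole element lies in `K ⊆ F` and its first summand in `IF ⊆ F`, so `ih ∈ F` and freeness
    -- kills `i`.
    have h0 : i = 0 := hfree i (hIK hi) ((F.add_mem_iff_right (hIF hy₁)).1 (hF.le hyK))
    subst h0
    rw [map_zero, add_zero] at hyK ⊢
    exact hF.pure I hIK hI ⟨hy₁, hyK⟩

theorem IsPureCoideal.toSubmodule {K : Subalgebra k H} (hK : IsHopfSubalgebra K) :
    IsPureCoideal K (Subalgebra.toSubmodule K) where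
  le := le_rfl
  mul_mem _ hx _ hy := K.mul_mem hx hy
  leftSlice_mem f x hx := (isSubcoalgebra_iff.1 hK.isSubcoalgebra f x hx).1
  pure _ _ hI := inf_le_left.trans (Submodule.mul_le.2 hI)

theorem isPureCoideal_sSup {K : Subalgebra k H} {c : Set (Submodule k H)}
    (hc : ∀ F ∈ c, IsPureCoideal K F) (hchain : IsChain (· ≤ ·) c) (hne : c.Nonempty) :
    IsPureCoideal K (sSup c) := by
  have hdir : DirectedOn (· ≤ ·) c := hchain.directedOn
  have hmem : ∀ {x}, x ∈ sSup c ↔ ∃ F ∈ c, x ∈ F := Submodule.mem_sSup_of_directed hne hdir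
  obtain ⟨F₀, hF₀⟩ := hne
  refine ⟨(hc F₀ hF₀).le.trans (le_sSup hF₀), ?_, ?_, ?_⟩
  · intro x hx y hy
    obtain ⟨F, hF, hyF⟩ := hmem.1 hy
    exact hmem.2 ⟨F, hF, (hc F hF).mul_mem x hx y hyF⟩
  · intro f y hy
    obtain ⟨F, hF, hyF⟩ := hmem.1 hy
    exact hmem.2 ⟨F, hF, (hc F hF).leftSlice_mem f y hyF⟩
  · rintro I hIK hI y ⟨hy, hyK⟩
    -- An element of the product involves only finitely many elements of the union, hence a single
    -- member of the chain.
    obtain ⟨F, hF, hyF⟩ : ∃ F ∈ c, y ∈ I * F := by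
      refine Submodule.mul_induction_on hy ?_ ?_
      · intro i hi z hz
        obtain ⟨F, hF, hzF⟩ := hmem.1 hz
        exact ⟨F, hF, Submodule.mul_mem_mul hi hzF⟩
      · rintro y z ⟨F, hF, hy⟩ ⟨F', hF', hz⟩
        obtain ⟨E, hE, hFE, hF'E⟩ := hdir F hF F' hF'
        exact ⟨E, hE, Submodule.add_mem _ (mul_le_mul' le_rfl hFE hy)
          (mul_le_mul' le_rfl hF'E hz)⟩
    exact (hc F hF).pure I hIK hI ⟨hyF, hyK⟩

/-- Right ideals of `K` are contracted from right ideals of `H`. -/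
theorem IsHopfSubalgebra.rightIdeal_mul_top_inf_le {K : Subalgebra k H} (hK : IsHopfSubalgebra K)
    (hKH : coradical k H ≤ Subalgebra.toSubmodule K ∨ IsPointedCoalgebra k H)
    (I : Submodule k H) (hIK : I ≤ Subalgebra.toSubmodule K)
    (hI : ∀ i ∈ I, ∀ x ∈ K, i * x ∈ I) : I * ⊤ ⊓ Subalgebra.toSubmodule K ≤ I := by
  obtain ⟨F, -, hF⟩ := zorn_le_nonempty₀ {F | IsPureCoideal K F}
    (fun c hc hchain F hF => ⟨sSup c, isPureCoideal_sSup hc hchain ⟨F, hF⟩, fun E => le_sSup⟩)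
    _ (IsPureCoideal.toSubmodule hK)
  have hP : IsPureCoideal K F := hF.prop
  -- For `F = H` purity is the claim itself.
  suffices h : F = ⊤ from h ▸ hP.pure I hIK hI
  by_contra hne
  obtain ⟨g, h, hg, hh, hgh⟩ : ∃ g h : H, IsGroupLikeElem k g ∧ h ∉ F ∧
      ∀ f : Module.Dual k H, leftSlice f h - f g • h ∈ F :=
    hKH.elim
      (fun hcor => exists_coinvariant_of_coradical_le hK hcor F hP.leftSlice_mem hP.mul_mem hne)
      (fun hp => exists_semiinvariant_of_isPointed hp F hP.leftSlice_mem hne)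
  refine hh (hF.le_of_ge (hP.sup_mul_semiinvariant hK hg hh hgh) le_sup_left
    (Submodule.mem_sup_right ⟨1, K.one_mem, by simp⟩))

/-- Right Noetherianity descends to `K`. -/
theorem IsHopfSubalgebra.isRightNoetherian {K : Subalgebra k H} (hK : IsHopfSubalgebra K)
    (hKH : coradical k H ≤ Subalgebra.toSubmodule K ∨ IsPointedCoalgebra k H)
    (hH : IsRightNoetherian H) : IsRightNoetherian K := by
  let φ : Kᵐᵒᵖ →+* Hᵐᵒᵖ := K.val.toRingHom.op
  have hcontr : ∀ J : Ideal Kᵐᵒᵖ, (J.map φ).comap φ ≤ J := by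
    intro J x hx
    let I : Submodule k H :=
      { carrier := {y | ∃ z ∈ J, (z.unop : H) = y}
        add_mem' := by
          rintro _ _ ⟨y, hy, rfl⟩ ⟨z, hz, rfl⟩
          exact ⟨y + z, J.add_mem hy hz, rfl⟩
        zero_mem' := ⟨0, J.zero_mem, rfl⟩
        smul_mem' := by
          rintro c _ ⟨y, hy, rfl⟩
          refine ⟨MulOpposite.op (algebraMap k K c) * y, J.mul_mem_left _ hy, ?_⟩
          simp [Algebra.smul_def, Algebra.commutes] }
    have hmap : ∀ w ∈ J.map φ, w.unop ∈ I * (⊤ : Submodule k H) := by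
      intro w hw
      induction hw using Submodule.span_induction with
      | zero => exact Submodule.zero_mem _
      | add a b _ _ ha hb => exact Submodule.add_mem _ ha hb
      | mem a ha =>
        obtain ⟨z, hz, rfl⟩ := ha
        rw [← mul_one (φ z).unop]
        exact Submodule.mul_mem_mul ⟨z, hz, rfl⟩ trivial
      | smul r a _ ha =>
        have h1 := Submodule.mul_mem_mul ha (Submodule.mem_top (R := k) (x := r.unop))
        rw [mul_assoc] at h1
        exact (mul_le_mul' le_rfl le_top : I * (⊤ * ⊤) ≤ I * ⊤) h1
    have hxI : ((x.unop : K) : H) ∈ I := by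
      refine hK.rightIdeal_mul_top_inf_le hKH I ?_ ?_ ⟨hmap _ hx, x.unop.2⟩
      · rintro _ ⟨z, -, rfl⟩
        exact z.unop.2
      · rintro _ ⟨z, hz, rfl⟩ y hy
        exact ⟨MulOpposite.op ⟨y, hy⟩ * z, J.mul_mem_left _ hz, rfl⟩
    obtain ⟨z, hz, hzx⟩ := hxI
    have : z = x := MulOpposite.unop_injective (Subtype.ext hzx)
    exact this ▸ hz
  -- Ideals with the same extension have the same contraction of it, which returns each of them.
  have hstrict : StrictMono (Ideal.map φ) := fun J J' hJ =>
    lt_of_le_of_ne (Ideal.map_mono hJ.le) fun heq => hJ.not_ge <|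
      (Ideal.le_comap_map).trans ((congrArg (Ideal.comap φ) heq.symm).le.trans (hcontr J))
  have : WellFoundedGT (Ideal Hᵐᵒᵖ) := isNoetherian_iff'.1 hH
  exact isNoetherian_iff'.2 hstrict.wellFoundedGT

end Purity

/-! ### Exchanging left and right. Reversing both structures keeps `S` an antipode, whereas
reversing only one would require an inverse of `S`. -/

section OpCop

open Coalgebra HopfAlgebra TensorProduct

/-- The Hopf algebra with both multiplication and comultiplication reversed. -/
def OpCop (H : Type*) : Type _ := Hᵐᵒᵖ

variable {k H : Type*} [Field k] [Ring H]

instance : Ring (OpCop H) := inferInstanceAs (Ring Hᵐᵒᵖ)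

instance [Algebra k H] : Algebra k (OpCop H) := inferInstanceAs (Algebra k Hᵐᵒᵖ)

namespace OpCop

variable (k H) in
/-- The identity map to the opposite co-opposite Hopf algebra. -/
def equiv [Algebra k H] : H ≃ₗ[k] OpCop H := MulOpposite.opLinearEquiv k

theorem equiv_mul [Algebra k H] (x y : H) : equiv k H (x * y) = equiv k H y * equiv k H x := rfl

theorem equiv_one [Algebra k H] : equiv k H 1 = 1 := rfl

variable (k H) in
/-- Swapping the tensor factors, followed by the identity map to the opposite. -/
noncomputable def swap [Algebra k H] : H ⊗[k] H →ₗ[k] OpCop H ⊗[k] OpCop H :=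
  TensorProduct.map (equiv k H).toLinearMap (equiv k H).toLinearMap ∘ₗ
    (TensorProduct.comm k H H).toLinearMap

@[simp]
theorem swap_tmul [Algebra k H] (x y : H) :
    swap k H (x ⊗ₜ y) = equiv k H y ⊗ₜ equiv k H x := rfl

theorem swap_mul [Algebra k H] (s t : H ⊗[k] H) : swap k H (s * t) = swap k H t * swap k H s := by
  induction s with
  | zero => simp
  | add s s' hs hs' => simp [add_mul, mul_add, hs, hs']
  | tmul a b =>
    induction t with
    | zero => simp
    | add t t' ht ht' => simp [add_mul, mul_add, ht, ht']
    | tmul c d => simp [equiv_mul]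

variable [HopfAlgebra k H]

noncomputable instance : CoalgebraStruct k (OpCop H) where
  comul := swap k H ∘ₗ comul ∘ₗ (equiv k H).symm.toLinearMap
  counit := counit ∘ₗ (equiv k H).symm.toLinearMap

theorem comul_equiv (x : H) : comul (R := k) (equiv k H x) = swap k H (comul x) := by
  change swap k H (comul ((equiv k H).symm (equiv k H x))) = _
  rw [LinearEquiv.symm_apply_apply]

theorem counit_equiv (x : H) : counit (R := k) (equiv k H x) = counit (R := k) x := by
  change counit ((equiv k H).symm (equiv k H x)) = _
  rw [LinearEquiv.symm_apply_apply]

noncomputable instance : Coalgebra k (OpCop H) where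
  coassoc := by
    let σ : H ⊗[k] (H ⊗[k] H) →ₗ[k] OpCop H ⊗[k] (OpCop H ⊗[k] OpCop H) :=
      (TensorProduct.assoc k _ _ _).toLinearMap ∘ₗ
        TensorProduct.map (swap k H) (equiv k H).toLinearMap ∘ₗ
          (TensorProduct.comm k _ _).toLinearMap
    have h1 : ∀ t : H ⊗[k] H, TensorProduct.assoc k _ _ _
        (comul.rTensor (OpCop H) (swap k H t)) = σ (comul.lTensor H t) := by
      intro t
      induction t with
      | zero => simp
      | add s t hs ht => simp only [map_add, hs, ht]
      | tmul x y => simp [σ, comul_equiv]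
    have h2 : ∀ t : H ⊗[k] H, comul.lTensor (OpCop H) (swap k H t) =
        σ (TensorProduct.assoc k _ _ _ (comul.rTensor H t)) := by
      intro t
      induction t with
      | zero => simp
      | add s t hs ht => simp only [map_add, hs, ht]
      | tmul x y =>
        simp only [swap_tmul, LinearMap.lTensor_tmul, LinearMap.rTensor_tmul, comul_equiv]
        rw [← (ℛ k x).eq]
        simp [σ, TensorProduct.sum_tmul, TensorProduct.tmul_sum]
    ext x
    obtain ⟨x, rfl⟩ := (equiv k H).surjective x
    simp only [LinearMap.comp_apply, LinearEquiv.coe_coe, comul_equiv]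
    rw [h1, h2, coassoc_apply]
  rTensor_counit_comp_comul := by
    have h : ∀ t : H ⊗[k] H, counit.rTensor (OpCop H) (swap k H t) =
        TensorProduct.map LinearMap.id (equiv k H).toLinearMap
          (TensorProduct.comm k _ _ (counit.lTensor H t)) := by
      intro t
      induction t with
      | zero => simp
      | add s t hs ht => simp only [map_add, hs, ht]
      | tmul x y => simp [counit_equiv]
    ext x
    obtain ⟨x, rfl⟩ := (equiv k H).surjective x
    simp [LinearMap.comp_apply, comul_equiv, h]
  lTensor_counit_comp_comul := by
    have h : ∀ t : H ⊗[k] H, counit.lTensor (OpCop H) (swap k H t) =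
        TensorProduct.map (equiv k H).toLinearMap LinearMap.id
          (TensorProduct.comm k _ _ (counit.rTensor H t)) := by
      intro t
      induction t with
      | zero => simp
      | add s t hs ht => simp only [map_add, hs, ht]
      | tmul x y => simp [counit_equiv]
    ext x
    obtain ⟨x, rfl⟩ := (equiv k H).surjective x
    simp [LinearMap.comp_apply, comul_equiv, h]

noncomputable instance : Bialgebra k (OpCop H) :=
  Bialgebra.mk' k (OpCop H)
    (by rw [← equiv_one (k := k), counit_equiv, Bialgebra.counit_one])
    (fun {x y} => by
      obtain ⟨x, rfl⟩ := (equiv k H).surjective x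
      obtain ⟨y, rfl⟩ := (equiv k H).surjective y
      rw [← equiv_mul, counit_equiv, counit_equiv, counit_equiv, Bialgebra.counit_mul, mul_comm])
    (by
      rw [← equiv_one (k := k), comul_equiv, Bialgebra.comul_one]
      rfl)
    (fun {x y} => by
      obtain ⟨x, rfl⟩ := (equiv k H).surjective x
      obtain ⟨y, rfl⟩ := (equiv k H).surjective y
      rw [← equiv_mul, comul_equiv, comul_equiv, comul_equiv, Bialgebra.comul_mul, swap_mul])

noncomputable instance : HopfAlgebraStruct k (OpCop H) where
  antipode := (equiv k H).toLinearMap ∘ₗ antipode k ∘ₗ (equiv k H).symm.toLinearMap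

theorem antipode_equiv (x : H) : antipode k (equiv k H x) = equiv k H (antipode k x) := by
  change equiv k H (antipode k ((equiv k H).symm (equiv k H x))) = _
  rw [LinearEquiv.symm_apply_apply]

noncomputable instance : HopfAlgebra k (OpCop H) where
  mul_antipode_rTensor_comul := by
    have h : ∀ t : H ⊗[k] H,
        LinearMap.mul' k (OpCop H) ((antipode k).rTensor (OpCop H) (swap k H t)) =
        equiv k H (LinearMap.mul' k H ((antipode k).lTensor H t)) := by
      intro t
      induction t with
      | zero => simp
      | add s t hs ht => simp only [map_add, hs, ht]
      | tmul x y => simp [antipode_equiv, equiv_mul]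
    ext x
    obtain ⟨x, rfl⟩ := (equiv k H).surjective x
    simp only [LinearMap.comp_apply, comul_equiv, h, mul_antipode_lTensor_comul_apply,
      counit_equiv]
    rfl
  mul_antipode_lTensor_comul := by
    have h : ∀ t : H ⊗[k] H,
        LinearMap.mul' k (OpCop H) ((antipode k).lTensor (OpCop H) (swap k H t)) =
        equiv k H (LinearMap.mul' k H ((antipode k).rTensor H t)) := by
      intro t
      induction t with
      | zero => simp
      | add s t hs ht => simp only [map_add, hs, ht]
      | tmul x y => simp [antipode_equiv, equiv_mul]
    ext x
    obtain ⟨x, rfl⟩ := (equiv k H).surjective x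
    simp only [LinearMap.comp_apply, comul_equiv, h, mul_antipode_rTensor_comul_apply,
      counit_equiv]
    rfl

/-- Passing to the co-opposite exchanges left and right slices, and the slice criterion is symmetric
in them. -/
theorem isSubcoalgebra_map_equiv {D : Submodule k H} :
    IsSubcoalgebra k (D.map (equiv k H).toLinearMap) ↔ IsSubcoalgebra k D := by
  have hl : ∀ (f : Module.Dual k (OpCop H)) x, leftSlice f (equiv k H x) =
      equiv k H (rightSlice (f ∘ₗ (equiv k H).toLinearMap) x) := by
    intro f x
    rw [rightSlice_eq_sum (ℛ k x).eq.symm]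
    simp only [leftSlice, LinearMap.comp_apply, comul_equiv]
    rw [← (ℛ k x).eq]
    simp
  have hr : ∀ (f : Module.Dual k (OpCop H)) x, rightSlice f (equiv k H x) =
      equiv k H (leftSlice (f ∘ₗ (equiv k H).toLinearMap) x) := by
    intro f x
    rw [leftSlice_eq_sum (ℛ k x).eq.symm]
    simp only [rightSlice, LinearMap.comp_apply, comul_equiv]
    rw [← (ℛ k x).eq]
    simp
  have hm : ∀ x, equiv k H x ∈ D.map (equiv k H).toLinearMap ↔ x ∈ D := fun x =>
    ⟨fun ⟨y, hy, hyx⟩ => (equiv k H).injective hyx ▸ hy, fun hx => ⟨x, hx, rfl⟩⟩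
  rw [isSubcoalgebra_iff, isSubcoalgebra_iff]
  constructor
  · intro h f x hx
    have := h (f ∘ₗ (equiv k H).symm.toLinearMap) _ ((hm x).2 hx)
    rw [hl, hr, hm, hm, LinearMap.comp_assoc, LinearEquiv.comp_coe,
      LinearEquiv.self_trans_symm] at this
    exact this.symm
  · rintro h f _ ⟨x, hx, rfl⟩
    rw [LinearEquiv.coe_coe, hl, hr, hm, hm]
    exact (h _ x hx).symm

theorem isSimpleSubcoalgebra_map_equiv {D : Submodule k H} :
    IsSimpleSubcoalgebra k (D.map (equiv k H).toLinearMap) ↔ IsSimpleSubcoalgebra k D := by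
  let Φ := Submodule.orderIsoMapComap (equiv k H)
  have hΦ : ∀ E, IsSubcoalgebra k (Φ E) ↔ IsSubcoalgebra k E := fun E => isSubcoalgebra_map_equiv
  change IsSimpleSubcoalgebra k (Φ D) ↔ _
  simp only [IsSimpleSubcoalgebra, hΦ, Φ.surjective.forall, Φ.le_iff_le, Φ.injective.eq_iff,
    ne_eq, map_eq_bot_iff]

theorem coradical_eq_map :
    coradical k (OpCop H) = (coradical k H).map (equiv k H).toLinearMap := by
  let Φ := Submodule.orderIsoMapComap (equiv k H)
  have hΦ : ∀ E, IsSimpleSubcoalgebra k (Φ E) ↔ IsSimpleSubcoalgebra k E := fun E =>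
    isSimpleSubcoalgebra_map_equiv
  change _ = Φ (coradical k H)
  rw [coradical, coradical, OrderIso.map_sSup, sSup_eq_iSup, ← Φ.surjective.iSup_comp]
  simp only [Set.mem_ofPred_eq, hΦ]

theorem isGroupLikeElem_equiv {g : H} (hg : IsGroupLikeElem k g) :
    IsGroupLikeElem k (equiv k H g) where
  counit_eq_one := by rw [counit_equiv, hg.counit_eq_one]
  comul_eq_tmul_self := by rw [comul_equiv, hg.comul_eq_tmul_self, swap_tmul]

theorem isGroupLikeElem_of_equiv {g : H} (hg : IsGroupLikeElem k (equiv k H g)) :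
    IsGroupLikeElem k g where
  counit_eq_one := by rw [← counit_equiv, hg.counit_eq_one]
  comul_eq_tmul_self := by
    have hinj : Function.Injective (swap k H) :=
      (TensorProduct.congr (equiv k H) (equiv k H)).injective.comp
        (TensorProduct.comm k H H).injective
    refine hinj ?_
    rw [← comul_equiv, hg.comul_eq_tmul_self, swap_tmul]

theorem isPointedCoalgebra (hp : IsPointedCoalgebra k H) : IsPointedCoalgebra k (OpCop H) := by
  rw [IsPointedCoalgebra, coradical_eq_map, hp, Submodule.map_span]
  congr 1
  ext x
  obtain ⟨x, rfl⟩ := (equiv k H).surjective x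
  constructor
  · rintro ⟨g, hg, hgx⟩
    exact hgx ▸ isGroupLikeElem_equiv hg
  · exact fun hx => ⟨x, isGroupLikeElem_of_equiv hx, rfl⟩

/-- The image of a subalgebra in the opposite co-opposite Hopf algebra. -/
def subalgebra (K : Subalgebra k H) : Subalgebra k (OpCop H) where
  __ := (Subalgebra.toSubmodule K).map (equiv k H).toLinearMap
  mul_mem' := by
    rintro _ _ ⟨x, hx, rfl⟩ ⟨y, hy, rfl⟩
    exact ⟨y * x, K.mul_mem hy hx, rfl⟩
  algebraMap_mem' r := ⟨algebraMap k H r, K.algebraMap_mem r, rfl⟩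

theorem isHopfSubalgebra {K : Subalgebra k H} (hK : IsHopfSubalgebra K) :
    IsHopfSubalgebra (subalgebra K) where
  isSubcoalgebra := isSubcoalgebra_map_equiv.2 hK.isSubcoalgebra
  antipode_mem := by
    rintro _ ⟨x, hx, rfl⟩
    rw [LinearEquiv.coe_coe, antipode_equiv]
    exact ⟨_, hK.antipode_mem x hx, rfl⟩

/-- The opposite of the opposite co-opposite is the original ring. -/
def ringEquivOp : H ≃+* (OpCop H)ᵐᵒᵖ := RingEquiv.opOp H

/-- The opposite of the image of `K` is `K`. -/
noncomputable def subalgebraRingEquivOp (K : Subalgebra k H) : (subalgebra K)ᵐᵒᵖ ≃+* K :=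
  RingEquiv.symm <| RingEquiv.ofBijective
    ({ toFun := fun x => MulOpposite.op ⟨equiv k H x, x, x.2, rfl⟩
       map_one' := rfl
       map_mul' := fun _ _ => rfl
       map_zero' := rfl
       map_add' := fun _ _ => rfl } : K →+* (subalgebra K)ᵐᵒᵖ)
    ⟨fun x y hxy => Subtype.ext ((equiv k H).injective
      (congrArg Subtype.val (MulOpposite.op_injective hxy))), fun y => by
      obtain ⟨⟨_, x, hx, rfl⟩⟩ := y
      exact ⟨⟨x, hx⟩, rfl⟩⟩

end OpCop

end OpCop

theorem mainTheorem4 {k H : Type*} [Field k] [Ring H] [HopfAlgebra k H]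
    (K : Subalgebra k H) (hK : IsHopfSubalgebra K)
    (h : coradical k H ≤ Subalgebra.toSubmodule K ∨ IsPointedCoalgebra k H) :
    (IsRightNoetherian H → IsRightNoetherian K) ∧ (IsLeftNoetherian H → IsLeftNoetherian K) := by
  refine ⟨hK.isRightNoetherian h, fun hH => ?_⟩
  -- Right ideals of `OpCop H` are left ideals of `H`.
  have hH' : IsRightNoetherian (OpCop H) := isNoetherianRing_of_ringEquiv H OpCop.ringEquivOp
  have h' : coradical k (OpCop H) ≤ Subalgebra.toSubmodule (OpCop.subalgebra K) ∨
      IsPointedCoalgebra k (OpCop H) :=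
    h.imp (fun hcor => OpCop.coradical_eq_map.le.trans (Submodule.map_mono hcor))
      OpCop.isPointedCoalgebra
  have := (OpCop.isHopfSubalgebra hK).isRightNoetherian h' hH'
  exact isNoetherianRing_of_ringEquiv _ (OpCop.subalgebraRingEquivOp K)
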